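/- Let $1\le i\le n-1$ and let $\mathcal K^n$ be the set of convex bodies (non-empty compact convex sets) in $\mathbb R^n$ with the Hausdorff metric; $h(K,u)=\max_{x\in K}\langle x,u\rangle$ is the support function of $K$, $\mathrm{Gr}_{i,n}$ is the Grassmannian of $i$-dimensional linear subspaces, and $\mathrm{vol}_i(K|E)$ is the $i$-dimensional volume of the orthogonal projection of $K$ onto $E$. All measures are finite signed Borel measures. Fix $\bar e\in S^{n-1}$ and $\bar E\in\mathrm{Gr}_{i,n}$, with stabilizers $\mathrm O(n-1)$ and $\mathrm O(i)\times\mathrm O(n-i)$ in $\mathrm O(n)$. Functions $f$ on $S^{n-1}$ or $\mathrm{Gr}_{i,n}$ are identified with the functions $\vartheta\mapsto f(\vartheta\bar e)$, respectively $\vartheta\mapsto f(\vartheta\bar E)$, on $\mathrm O(n)$. A measure $\mu$ on $S^{n-1}$ is identified with the measure $\breve\mu$ on $\mathrm O(n)$ given by $\int f\,d\breve\mu=\int_{S^{n-1}}\bar f\,d\mu$ for $f \in C(\mathrm O(n))$, where $\bar f(\eta\bar e)=\int_{\mathrm O(n-1)}f(\eta\vartheta)\,d\vartheta$ (Haar probability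 measure). For functions on $\mathrm O(n)$ put $\widehat f(\vartheta)=f(\vartheta^{-1})$, and for a measure $\nu$ on $\mathrm O(n)$ let $\widehat\nu$ be its image under $\vartheta\mapsto\vartheta^{-1}$. For a measure $\mu$ on $S^{n-1}$ let $\widehat\mu$ be the measure on $\mathrm{Gr}_{i,n}$ that is the image of $\widehat{\breve\mu}$ under $\vartheta\mapsto\vartheta\bar E$. For $f\in C(\mathrm{Gr}_{i,n})$ and a measure $\mu$ on $S^{n-1}$, the function $f*\mu$ on $S^{n-1}$ is given by $(f*\mu)(\eta\bar e)=\int_{\mathrm O(n)}f(\eta\vartheta^{-1}\bar E)\,d\breve\mu(\vartheta)$. The cosine transform of a measure $\sigma$ on $\mathrm{Gr}_{i,n}$ is $(\mathrm C_i\sigma)(F)=\int_{\mathrm{Gr}_{i,n}}|\cos(E,F)|\,d\sigma(E)$, where $|\cos(E,F)|$ is the $i$-dimensional volume of the orthogonal projection onto $F$ of a subset of $E$ of $i$-dimensional volume one. Let $\mathbf{MVal}_i^+$ be the set of maps $\Phi_i:\mathcal K^n\to\mathcal K^n$ that are continuous, translation invariant, $\mathrm O(n)$ equivariant, even ($\Phi_i(-K)=\Phi_iK$),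 homogeneous of degree $i$ ($\Phi_i(\lambda K)=\lambda^i\Phi_iK$ for $\lambda\ge0$) and Minkowski valuations, i.e. $\Phi_i(K\cup L)+\Phi_i(K\cap L)=\Phi_iK+\Phi_iL$ (Minkowski addition) whenever $K,L,K\cup L\in\mathcal K^n$. A measure $\mu$ on $S^{n-1}$ is a Crofton measure for $\Phi_i$ if $h(\Phi_iK,\cdot)=\mathrm{vol}_i(K|\,\cdot\,)*\mu$ for all $K\in\mathcal K^n$. **Theorem 6.2.** Let $\Phi_i\in\mathbf{MVal}_i^+$ with $1\le i\le n-1$, and let $\mu$ be a Crofton measure for $\Phi_i$. Then there is an $\mathrm O(i)\times\mathrm O(n-i)$ invariant convex body $L\in\mathcal K^n$ with $$h(L,\cdot)=\widehat{\mathrm C_i\widehat\mu},\qquad\text{that is,}\qquad h(L,\vartheta\bar e)=(\mathrm C_i\widehat\mu)(\vartheta^{-1}\bar E)\quad\text{for all }\vartheta\in\mathrm O(n).$$ In particular, the associated real-valued valuation $\varphi_i(K)=h(\Phi_iK,\bar e)$ has a Klain function, i.e. a function $g\in C(\mathrm{Gr}_{i,n})$ with $\varphi_i(K)=g(E)\,\mathrm{vol}_i(K)$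 for all $E\in\mathrm{Gr}_{i,n}$ and all convex bodies $K\subseteq E$, and $g=\widehat{h(L,\cdot)}$, that is, $g(\vartheta\bar E)=h(L,\vartheta^{-1}\bar e)$ for all $\vartheta\in\mathrm O(n)$. -/

import Mathlib

open MeasureTheory ProbabilityTheory Set
open scoped Pointwise

noncomputable section

namespace MinkVal

/-! ### Euclidean space, sphere, orthogonal group, Grassmannian -/

/-- `ℝⁿ` with its Euclidean structure. -/
abbrev V (n : ℕ) : Type := EuclideanSpace ℝ (Fin n)

/-- The unit sphere `S^{n-1}`. -/
abbrev S (n : ℕ) : Type := Metric.sphere (0 : V n) 1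

instance (n : ℕ) : ContinuousStar (V n →L[ℝ] V n) :=
  ⟨(LinearIsometryEquiv.continuous
    (ContinuousLinearMap.adjoint : (V n →L[ℝ] V n) ≃ₗᵢ⋆[ℝ] (V n →L[ℝ] V n)) :)⟩

/-- The orthogonal group `O(n)`: the linear maps `θ` of `ℝⁿ` with `θᵀ θ = θ θᵀ = 1`, with the
topology of the operator norm. -/
abbrev O (n : ℕ) : Type := unitary (V n →L[ℝ] V n)

/-- The Grassmannian `Gr_{i,n}` of `i`-dimensional linear subspaces of `ℝⁿ`. -/
def Gr (n i : ℕ) : Type := {E : Submodule ℝ (V n) // Module.finrank ℝ E = i}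

/-- The usual topology of the Grassmannian: `E` is identified with the orthogonal projection
onto `E`. -/
instance (n i : ℕ) : TopologicalSpace (Gr n i) :=
  TopologicalSpace.induced (fun E : Gr n i => E.1.starProjection) inferInstance

instance (n i : ℕ) : MeasurableSpace (Gr n i) := borel _

instance (n i : ℕ) : BorelSpace (Gr n i) := ⟨rfl⟩

lemma norm_apply {n : ℕ} (θ : O n) (x : V n) : ‖θ.1 x‖ = ‖x‖ := Unitary.norm_map θ x

/-- The orbit map `θ ↦ θ e₀` from `O(n)` to the sphere. If `e₀` is the base point of the sphere,
this is the canonical projection `O(n) → O(n)/O(n-1) = S^{n-1}`. -/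
def toSphere {n : ℕ} (e₀ : S n) (θ : O n) : S n :=
  ⟨θ.1 e₀, by
    have h : ‖(e₀ : V n)‖ = 1 := by simp
    rw [mem_sphere_zero_iff_norm, norm_apply, h]⟩

/-- The orbit map `θ ↦ θ E₀` from `O(n)` to the Grassmannian. If `E₀` is the base point, this is
the canonical projection `O(n) → O(n)/(O(i) × O(n-i)) = Gr_{i,n}`. -/
def toGr {n i : ℕ} (E₀ : Gr n i) (θ : O n) : Gr n i :=
  ⟨E₀.1.map (Unitary.linearIsometryEquiv θ).toLinearEquiv.toLinearMap, by
    rw [LinearEquiv.finrank_map_eq]; exact E₀.2⟩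

/-- The stabilizer of the base point of the sphere, i.e. the subgroup `O(n-1)` of `O(n)`. -/
def stab {n : ℕ} (e₀ : S n) : Subgroup (O n) where
  carrier := {θ | θ.1 e₀ = e₀}
  one_mem' := by simp
  mul_mem' := by
    intro a b ha hb
    simp only [mem_ofPred_eq] at *
    simp [hb, ha]
  inv_mem' := by
    intro a ha
    simp only [mem_ofPred_eq] at *
    have h : ((a⁻¹ * a : O n) : V n →L[ℝ] V n) e₀ = e₀ := by simp
    have h' : ((a⁻¹ * a : O n) : V n →L[ℝ] V n) e₀ = (a⁻¹ : O n).1 (a.1 e₀) := rfl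
    rw [h', ha] at h
    exact h

lemma isClosed_unitary (n : ℕ) : IsClosed (unitary (V n →L[ℝ] V n) : Set (V n →L[ℝ] V n)) := by
  have : (unitary (V n →L[ℝ] V n) : Set (V n →L[ℝ] V n))
      = {a | star a * a = 1} ∩ {a | a * star a = 1} := by
    ext a; simp [Unitary.mem_iff]
  rw [this]
  exact (isClosed_eq (by fun_prop) continuous_const).inter
    (isClosed_eq (by fun_prop) continuous_const)

instance (n : ℕ) : CompactSpace (O n) := by
  apply isCompact_iff_compactSpace.mp
  have : ProperSpace (V n →L[ℝ] V n) := FiniteDimensional.proper ℝ _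
  refine Metric.isCompact_of_isClosed_isBounded (isClosed_unitary n) ?_
  refine (Metric.isBounded_closedBall (x := (0 : V n →L[ℝ] V n)) (r := 1)).subset ?_
  intro a ha
  rw [mem_closedBall_zero_iff]
  refine ContinuousLinearMap.opNorm_le_bound _ zero_le_one (fun x => ?_)
  rw [one_mul]
  exact (norm_apply ⟨a, ha⟩ x).le

lemma continuous_toSphere {n : ℕ} (e₀ : S n) : Continuous (toSphere e₀) := by
  unfold toSphere
  fun_prop

lemma toSphere_mul {n : ℕ} (e₀ : S n) (θ η : O n) :
    (toSphere e₀ (θ * η) : V n) = θ.1 (η.1 e₀) := rfl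

/-- `O(n)` acts transitively on the sphere. -/
lemma toSphere_surjective {n : ℕ} (e₀ : S n) : Function.Surjective (toSphere e₀) := by
  intro u
  have h : ‖(e₀ : V n)‖ = ‖(u : V n)‖ := by simp
  refine ⟨Unitary.linearIsometryEquiv.symm
    (Submodule.reflection (Submodule.span ℝ {(e₀ : V n) - u})ᗮ), ?_⟩
  apply Subtype.ext
  exact Submodule.reflection_sub h

instance {n : ℕ} (e₀ : S n) : CompactSpace (stab e₀) := by
  apply isCompact_iff_compactSpace.mp
  apply IsClosed.isCompact
  have : ((stab e₀ : Subgroup (O n)) : Set (O n)) = {θ : O n | θ.1 e₀ = e₀} := rfl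
  rw [this]
  exact isClosed_eq (by fun_prop) continuous_const

instance (n : ℕ) : PolishSpace (O n) := by
  have : ProperSpace (V n →L[ℝ] V n) := FiniteDimensional.proper ℝ _
  exact (isClosed_unitary n).polishSpace

/-! ### Measures and convolution

All measures are finite signed Borel measures. -/

/-- The Haar probability measure of a compact group. -/
def haarProb (G : Type) [Group G] [TopologicalSpace G] [IsTopologicalGroup G] [CompactSpace G]
    [MeasurableSpace G] [BorelSpace G] : Measure G :=
  Measure.haarMeasure ⊤

instance (G : Type) [Group G] [TopologicalSpace G] [IsTopologicalGroup G] [CompactSpace G]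
    [MeasurableSpace G] [BorelSpace G] : IsProbabilityMeasure (haarProb G) :=
  ⟨by
    have := Measure.haarMeasure_self (G := G) (K₀ := ⊤)
    simpa [haarProb] using this⟩

/-- The image of the Haar probability measure of `O(n-1)` under `θ ↦ η θ`: the invariant
probability measure on the coset `η O(n-1)`. -/
def cosetMeasure {n : ℕ} (e₀ : S n) (η : O n) : Measure (O n) :=
  (haarProb (stab e₀)).map (fun θ : stab e₀ => η * (θ : O n))

/-- The coset measure only depends on the coset, i.e. on the point `η e₀` of the sphere. -/
lemma cosetMeasure_congr {n : ℕ} (e₀ : S n) {η ζ : O n} (h : toSphere e₀ η = toSphere e₀ ζ) :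
    cosetMeasure e₀ η = cosetMeasure e₀ ζ := by
  have hv : η.1 e₀ = ζ.1 e₀ := congrArg Subtype.val h
  have hmem : ζ⁻¹ * η ∈ stab e₀ := by
    change (ζ⁻¹ : O n).1 (η.1 e₀) = e₀
    rw [hv]
    change ((ζ⁻¹ * ζ : O n) : V n →L[ℝ] V n) e₀ = e₀
    simp
  have hinv : (haarProb (stab e₀)).map (fun θ => (⟨ζ⁻¹ * η, hmem⟩ : stab e₀) * θ)
      = haarProb (stab e₀) := by
    unfold haarProb
    exact map_mul_left_eq_self _ _
  unfold cosetMeasure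
  conv_rhs => rw [← hinv]
  rw [Measure.map_map (by fun_prop) (by fun_prop)]
  congr 1
  funext θ
  simp [mul_assoc]

/-- The invariant probability measure on the coset `{θ ∈ O(n) : θ e₀ = u}` of `O(n-1)`, as a
probability kernel from the sphere to `O(n)`. For `f : O(n) → ℝ` and `u = η e₀`,
integrating `f` against it gives `∫_{O(n-1)} f (η θ) dθ`. -/
def cosetKernel {n : ℕ} (e₀ : S n) : Kernel (S n) (O n) where
  toFun u := cosetMeasure e₀ (Function.surjInv (toSphere_surjective e₀) u)
  measurable' := by
    rw [← (continuous_toSphere e₀).measurable.measurable_comp_iff_of_surjective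
      (toSphere_surjective e₀)]
    have : (fun u => cosetMeasure e₀ (Function.surjInv (toSphere_surjective e₀) u)) ∘ toSphere e₀
        = cosetMeasure e₀ := by
      funext η
      exact cosetMeasure_congr e₀ (Function.surjInv_eq (toSphere_surjective e₀) _)
    rw [this]
    refine Measure.measurable_of_measurable_coe _ (fun s hs => ?_)
    have hm : Measurable (fun p : O n × stab e₀ => p.1 * (p.2 : O n)) := by fun_prop
    have h2 := measurable_measure_prodMk_left (ν := haarProb (stab e₀)) (hm hs)
    convert h2 using 2 with η
    rw [cosetMeasure, Measure.map_apply (by fun_prop) hs]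
    rfl

instance {n : ℕ} (e₀ : S n) : IsMarkovKernel (cosetKernel e₀) :=
  ⟨fun u => by
    change IsProbabilityMeasure (cosetMeasure e₀ _)
    unfold cosetMeasure
    exact Measure.isProbabilityMeasure_map (by fun_prop)⟩

/-- Integration against the coset kernel is averaging over `O(n-1)`. -/
lemma cosetKernel_toSphere {n : ℕ} (e₀ : S n) (η : O n) :
    cosetKernel e₀ (toSphere e₀ η) = (haarProb (stab e₀)).map (fun θ : stab e₀ => η * (θ : O n)) :=
  cosetMeasure_congr e₀ (Function.surjInv_eq (toSphere_surjective e₀) _)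

/-- The right `O(n-1)`-invariant measure `μ̆` on `O(n)` that corresponds to a signed measure `μ` on
the sphere: `⟨μ̆, f⟩ = ⟨μ, f̄⟩` with `f̄ (η e₀) = ∫_{O(n-1)} f (η θ) dθ`. -/
def lift {n : ℕ} (e₀ : S n) (μ : SignedMeasure (S n)) : SignedMeasure (O n) :=
  (μ.toJordanDecomposition.posPart.bind (cosetKernel e₀)).toSignedMeasure
    - (μ.toJordanDecomposition.negPart.bind (cosetKernel e₀)).toSignedMeasure

/-- The hat of a function on `O(n)`. -/
def hatFun {n : ℕ} (f : O n → ℝ) : O n → ℝ := fun θ => f θ⁻¹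

/-- The hat of a measure on `O(n)`, i.e. its image under inversion. -/
def hatMeasure {n : ℕ} (ν : SignedMeasure (O n)) : SignedMeasure (O n) := ν.map (fun θ => θ⁻¹)

/-- The convolution `f * ν` of a function and a measure on `O(n)`. -/
def conv {n : ℕ} (f : O n → ℝ) (ν : SignedMeasure (O n)) (η : O n) : ℝ :=
  ∫ᵛ θ, f (η * θ⁻¹) ∂<•ν

/-- The measure `μ̂` on the Grassmannian for a measure `μ` on the sphere: pass to the measure
`μ̆` on `O(n)`, take its hat, and regard the result as a measure on the quotient `Gr_{i,n}`. -/
def hatToGr {n i : ℕ} (e₀ : S n) (E₀ : Gr n i) (μ : SignedMeasure (S n)) :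
    SignedMeasure (Gr n i) :=
  (hatMeasure (lift e₀ μ)).map (toGr E₀)

/-! ### Volumes of projections and the cosine transform -/

/-- `vol_i(K|E)`, the `i`-dimensional volume of the orthogonal projection of `K` onto `E`. -/
def volProj {n i : ℕ} (K : Set (V n)) (E : Gr n i) : ℝ :=
  (μHE[i] (E.1.starProjection '' K)).toReal

/-- A unit cube in the subspace `E`. -/
def unitCube {n i : ℕ} (E : Gr n i) : Set (V n) :=
  Subtype.val '' parallelepiped (stdOrthonormalBasis ℝ E.1)

lemma unitCube_subset {n i : ℕ} (E : Gr n i) : unitCube E ⊆ E.1 := by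
  rintro _ ⟨x, -, rfl⟩
  exact x.2

lemma unitCube_vol {n i : ℕ} (E : Gr n i) : μHE[i] (unitCube E) = 1 := by
  obtain ⟨E, rfl⟩ := E
  unfold unitCube
  rw [Isometry.euclideanHausdorffMeasure_image isometry_subtype_coe]
  rw [InnerProductSpace.euclideanHausdorffMeasure_eq_volume]
  exact OrthonormalBasis.volume_parallelepiped _

/-- `|cos(E, F)|`, the `i`-dimensional volume of the projection onto `F` of a subset of `E` of
volume one. -/
def absCos {n i : ℕ} (E F : Gr n i) : ℝ := volProj (unitCube E) F

/-- The choice of the subset of `E` of volume one is irrelevant in the definition of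
`|cos(E, F)|`. -/
lemma volProj_eq_absCos {n i : ℕ} (E F : Gr n i) (M : Set (V n)) (hM : M ⊆ E.1)
    (h1 : μHE[i] M = 1) : volProj M F = absCos E F := by
  obtain ⟨E, rfl⟩ := E
  have key : ∀ N : Set (V n), N ⊆ E → μHE[Module.finrank ℝ E] N = 1 →
      μHE[Module.finrank ℝ E] (F.1.starProjection '' N) = ENNReal.ofReal
        (F.1.starProjection.toLinearMap ∘ₗ E.subtype).normDet := by
    intro N hN h1
    have hv : (Subtype.val : E → V n) '' (Subtype.val ⁻¹' N) = N := by
      apply image_preimage_eq_of_subset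
      simpa using hN
    have h := LinearMap.euclideanHausdorffMeasure_image
      (F.1.starProjection.toLinearMap ∘ₗ E.subtype) (Subtype.val ⁻¹' N : Set E)
    rw [← Isometry.euclideanHausdorffMeasure_image (f := (Subtype.val : E → V n))
      isometry_subtype_coe, hv, h1, mul_one] at h
    rw [← h]
    conv_lhs => rw [← hv]
    rw [image_image]
    rfl
  unfold absCos volProj
  rw [key _ hM h1, key _ (unitCube_subset ⟨E, rfl⟩) (unitCube_vol ⟨E, rfl⟩)]

/-- The cosine transform of a measure on the Grassmannian. -/
def cosineTransform {n i : ℕ} (ν : SignedMeasure (Gr n i)) (F : Gr n i) : ℝ :=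
  ∫ᵛ E, absCos E F ∂<•ν

/-! ### Convex bodies and Minkowski valuations -/

/-- The support function `h(K, u) = max {⟨x, u⟩ : x ∈ K}`. -/
def supp {n : ℕ} (K : ConvexBody (V n)) (u : V n) : ℝ :=
  sSup ((fun x => inner ℝ x u) '' (K : Set (V n)))

/-- The image `θ K` of a convex body under an orthogonal map. -/
def rot {n : ℕ} (θ : O n) (K : ConvexBody (V n)) : ConvexBody (V n) where
  carrier := θ.1 '' K
  convex' := K.convex.linear_image θ.1.toLinearMap
  isCompact' := K.isCompact.image θ.1.continuous
  nonempty' := K.nonempty.image _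

/-- The translate `K + x` of a convex body. -/
def translate {n : ℕ} (K : ConvexBody (V n)) (x : V n) : ConvexBody (V n) :=
  K + ⟨{x}, convex_singleton x, isCompact_singleton, singleton_nonempty x⟩

/-- The set `MVal_i^+`: continuous (in the Hausdorff metric), translation invariant,
`O(n)`-equivariant, even Minkowski valuations of degree `i`. -/
structure IsEvenMVal {n : ℕ} (i : ℕ) (Φ : ConvexBody (V n) → ConvexBody (V n)) : Prop where
  continuous : Continuous Φ
  valuation : ∀ K L M N : ConvexBody (V n), (M : Set (V n)) = (K : Set (V n)) ∪ L →
    (N : Set (V n)) = (K : Set (V n)) ∩ L →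
    Φ M + Φ N = Φ K + Φ L
  translation_invariant : ∀ K x, Φ (translate K x) = Φ K
  equivariant : ∀ (θ : O n) K, Φ (rot θ K) = rot θ (Φ K)
  degree : ∀ (c : ℝ) K, 0 ≤ c → Φ (c • K) = c ^ i • Φ K
  even : ∀ K, Φ ((-1 : ℝ) • K) = Φ K

/-- The signed measure `μ` on the sphere is a Crofton measure for `Φ`, i.e.
`h(Φ K, ·) = vol_i(K|·) * μ`, where functions on the sphere and on the Grassmannian are
identified with functions on `O(n)` by means of the base points `e₀` and `E₀`. -/
def IsCroftonMeasure {n i : ℕ} (e₀ : S n) (E₀ : Gr n i) (Φ : ConvexBody (V n) → ConvexBody (V n))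
    (μ : SignedMeasure (S n)) : Prop :=
  ∀ (K : ConvexBody (V n)) (η : O n),
    supp (Φ K) (toSphere e₀ η) = conv (volProj (K : Set (V n)) ∘ toGr E₀) (lift e₀ μ) η

/-- The associated real-valued valuation `φ(K) = h(Φ K, e₀)` of a Minkowski valuation. -/
def assocVal {n : ℕ} (e₀ : S n) (Φ : ConvexBody (V n) → ConvexBody (V n)) :
    ConvexBody (V n) → ℝ :=
  fun K => supp (Φ K) e₀

/-- `g` is the Klain function of `φ`: the restriction of `φ` to convex bodies in `E` is
`g(E) vol_i`, for each `i`-dimensional subspace `E`. -/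
def IsKlainFunction {n i : ℕ} (φ : ConvexBody (V n) → ℝ) (g : C(Gr n i, ℝ)) : Prop :=
  ∀ (E : Gr n i) (K : ConvexBody (V n)), (K : Set (V n)) ⊆ E.1 →
    φ K = g E * (μHE[i] (K : Set (V n))).toReal

end MinkVal

end

/-! On subsets `M` of an `i`-dimensional subspace `E`, projection to `F` is linear, so `vol_i(M|F) =
|cos(E,F)| vol_i(M)` (`volProj_eq_absCos_mul`). Insert this in the Crofton formula for a body `K ⊆
E`. Since the cosine is symmetric and `O(n)`-invariant, the integrand at `η` becomes `vol_i(K)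
|cos(η⁻¹E, θ⁻¹E₀)|`, whence `h(ΦK, ηe₀) = vol_i(K) (C_i μ̂)(η⁻¹E)` (`IsCroftonMeasure.supp_eq`).

Everything follows from this identity. With `E = E₀` and `K` the unit ball of `E₀`, it exhibits the
transform as the support function of a multiple of `ΦK`, so convexity comes for free. With `η = 1`,
it says that `C_i μ̂` is the Klain function. -/

noncomputable section

namespace MinkVal

variable {n i : ℕ}

/-! ### The volume of projections of subsets of a subspace -/

/-- An orthonormal basis of an `i`-dimensional subspace, indexed by `Fin i`. -/
def Gr.basis (E : Gr n i) : OrthonormalBasis (Fin i) ℝ E.1 :=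
  (stdOrthonormalBasis ℝ E.1).reindex (finCongr E.2)

lemma euclideanHausdorffMeasure_projection (E F : Gr n i) {M : Set (V n)} (hM : M ⊆ E.1) :
    μHE[i] (F.1.starProjection '' M) =
      ENNReal.ofReal (F.1.starProjection.toLinearMap ∘ₗ E.1.subtype).normDet * μHE[i] M := by
  -- Makes `i` literally `finrank E`, the dimension in the area formula for linear maps.
  obtain ⟨E, rfl⟩ := E
  have hv : (Subtype.val : E → V n) '' (Subtype.val ⁻¹' M) = M := by
    apply image_preimage_eq_of_subset
    simpa using hM
  have h := LinearMap.euclideanHausdorffMeasure_image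
    (F.1.starProjection.toLinearMap ∘ₗ E.subtype) (Subtype.val ⁻¹' M : Set E)
  rw [← Isometry.euclideanHausdorffMeasure_image (f := (Subtype.val : E → V n))
    isometry_subtype_coe, hv] at h
  rw [← h]
  conv_lhs => rw [← hv]
  rw [image_image]
  rfl

lemma absCos_eq_normDet (E F : Gr n i) :
    absCos E F = (F.1.starProjection.toLinearMap ∘ₗ E.1.subtype).normDet := by
  rw [absCos, volProj, euclideanHausdorffMeasure_projection E F (unitCube_subset E),
    unitCube_vol, mul_one, ENNReal.toReal_ofReal (LinearMap.normDet_nonneg _)]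

lemma volProj_eq_absCos_mul (E F : Gr n i) {M : Set (V n)} (hM : M ⊆ E.1) :
    volProj M F = absCos E F * (μHE[i] M).toReal := by
  rw [absCos_eq_normDet, volProj, euclideanHausdorffMeasure_projection E F hM, ENNReal.toReal_mul,
    ENNReal.toReal_ofReal (LinearMap.normDet_nonneg _)]

lemma absCos_eq_abs_det (E F : Gr n i) :
    absCos E F =
      |(Matrix.of fun k j => inner ℝ (F.basis k : V n) (E.basis j : V n)).det| := by
  have h := LinearMap.normDet_codRestrict (p := F.1)
    (f := F.1.starProjection.toLinearMap ∘ₗ E.1.subtype)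
    (fun c => Submodule.starProjection_apply_mem _ _)
  rw [absCos_eq_normDet, ← h, LinearMap.normDet_eq_norm_det_toMatrix _ E.basis F.basis, Real.norm_eq_abs]
  congr 2
  ext k j
  rw [LinearMap.toMatrix_apply, OrthonormalBasis.coe_toBasis_repr_apply,
    OrthonormalBasis.repr_apply_apply, Submodule.coe_inner]
  simp only [OrthonormalBasis.coe_toBasis, LinearMap.codRestrict_apply, Matrix.of_apply,
    LinearMap.comp_apply, Submodule.subtype_apply]
  change inner ℝ (F.basis k : V n) (F.1.starProjection (E.basis j : V n)) = _
  rw [← Submodule.inner_starProjection_left_eq_right,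
    Submodule.starProjection_eq_self_iff.mpr (F.basis k).2]

/-- Exchanging the subspaces transposes the matrix of inner products of their orthonormal bases. -/
lemma absCos_comm (E F : Gr n i) : absCos E F = absCos F E := by
  rw [absCos_eq_abs_det, absCos_eq_abs_det, ← Matrix.det_transpose]
  congr 2
  ext k j
  simp [real_inner_comm]

lemma absCos_nonneg (E F : Gr n i) : 0 ≤ absCos E F := ENNReal.toReal_nonneg

/-- Projections are 1-Lipschitz, so they do not increase Hausdorff measure. The bound serves as the
dominating function below. -/
lemma absCos_le_one (E F : Gr n i) : absCos E F ≤ 1 := by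
  have hL : LipschitzWith 1 F.1.starProjection :=
    F.1.starProjection.lipschitz.weaken (Submodule.starProjection_norm_le _)
  have h : μHE[i] (F.1.starProjection '' unitCube E) ≤ μHE[i] (unitCube E) := by
    simp_rw [Measure.euclideanHausdorffMeasure_def, Measure.smul_apply]
    refine smul_le_smul_of_nonneg_left ?_ zero_le
    simpa using hL.hausdorffMeasure_image_le (Nat.cast_nonneg i) (unitCube E)
  rw [unitCube_vol] at h
  exact ENNReal.toReal_le_of_le_ofReal zero_le_one (by simpa using h)

lemma Gr.continuous_starProjection : Continuous fun E : Gr n i => E.1.starProjection :=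
  continuous_induced_dom

/-- The chosen bases of `F` need not vary continuously. The Gram determinant of the projections of a
fixed basis of `E` involves `F` only through its projection, which defines the topology. -/
lemma continuous_absCos (E : Gr n i) : Continuous (absCos E) := by
  have h (F : Gr n i) : absCos E F
      = √(Matrix.gram ℝ fun j => F.1.starProjection (E.basis j : V n)).det := by
    have := LinearMap.normDet_sq_eq_det_gram
      (F.1.starProjection.toLinearMap ∘ₗ E.1.subtype) E.basis
    rw [← absCos_eq_normDet] at this
    change _ = √(Matrix.gram ℝ fun j =>
      (F.1.starProjection.toLinearMap ∘ₗ E.1.subtype) (E.basis j)).det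
    rw [← this]
    exact (Real.sqrt_sq (absCos_nonneg E F)).symm
  rw [funext h]
  have := Gr.continuous_starProjection (n := n) (i := i)
  refine Real.continuous_sqrt.comp (Continuous.matrix_det ?_)
  refine continuous_matrix fun k j => ?_
  simp only [Matrix.gram_apply]
  fun_prop

/-! ### The action of the orthogonal group on the Grassmannian -/

lemma toGr_mul (E : Gr n i) (θ η : O n) : toGr E (θ * η) = toGr (toGr E η) θ := by
  apply Subtype.ext
  simp only [toGr]
  rw [← Submodule.map_comp]
  rfl

lemma toGr_one (E : Gr n i) : toGr E 1 = E := by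
  apply Subtype.ext
  simp only [toGr]
  exact Submodule.map_id _

lemma starProjection_toGr_apply (E : Gr n i) (θ : O n) (x : V n) :
    (toGr E θ).1.starProjection (θ.1 x) = θ.1 (E.1.starProjection x) :=
  ((Unitary.linearIsometryEquiv θ).toLinearIsometry.map_starProjection' E.1 x).symm

lemma starProjection_toGr (E : Gr n i) (θ : O n) :
    (toGr E θ).1.starProjection = θ.1 ∘L E.1.starProjection ∘L (θ⁻¹ : O n).1 := by
  ext1 x
  have h : θ.1 ((θ⁻¹ : O n).1 x) = x := by
    change ((θ * θ⁻¹ : O n) : V n →L[ℝ] V n) x = x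
    simp
  conv_lhs => rw [← h, starProjection_toGr_apply]
  rfl

lemma continuous_toGr (E : Gr n i) : Continuous (toGr E) := by
  rw [continuous_induced_rng]
  change Continuous fun θ : O n => (toGr E θ).1.starProjection
  simp_rw [starProjection_toGr]
  have h : Continuous fun θ : O n => (θ⁻¹ : O n).1 := continuous_subtype_val.comp continuous_inv
  exact continuous_subtype_val.clm_comp (continuous_const.clm_comp h)

lemma volProj_image_toGr (M : Set (V n)) (F : Gr n i) (θ : O n) :
    volProj (θ.1 '' M) (toGr F θ) = volProj M F := by
  have h : (toGr F θ).1.starProjection '' (θ.1 '' M) = θ.1 '' (F.1.starProjection '' M) := by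
    simp_rw [image_image, starProjection_toGr_apply]
  rw [volProj, h, Isometry.euclideanHausdorffMeasure_image
    (AddMonoidHomClass.isometry_of_norm θ.1 (norm_apply θ))]
  rfl

lemma absCos_toGr_toGr (E F : Gr n i) (θ : O n) :
    absCos (toGr E θ) (toGr F θ) = absCos E F := by
  -- Any set of volume one in `θE` computes the cosine; the rotated cube of `E` is the convenient
  -- one.
  rw [← volProj_eq_absCos (toGr E θ) _ (θ.1 '' unitCube E), volProj_image_toGr, absCos]
  · exact image_mono (unitCube_subset E)
  · rw [Isometry.euclideanHausdorffMeasure_image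
      (AddMonoidHomClass.isometry_of_norm θ.1 (norm_apply θ)), unitCube_vol]

lemma absCos_toGr_inv (E F : Gr n i) (θ : O n) :
    absCos (toGr E θ⁻¹) F = absCos E (toGr F θ) := by
  rw [← absCos_toGr_toGr _ _ θ, ← toGr_mul, mul_inv_cancel, toGr_one]

/-! ### The cosine transform -/

/-- Dominated convergence is sequential; this lets it yield continuity on the Grassmannian. -/
instance (n i : ℕ) : FirstCountableTopology (Gr n i) :=
  TopologicalSpace.firstCountableTopology_induced _ _ _

instance {X : Type*} [MeasurableSpace X] (ν : SignedMeasure X) : IsFiniteMeasure ν.variation := by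
  rw [← ν.totalVariation_eq_variation]
  infer_instance

lemma integrable_absCos (ν : SignedMeasure (Gr n i)) (F : Gr n i) :
    ν.Integrable fun E => absCos E F := by
  simp_rw [absCos_comm _ F]
  refine Integrable.of_bound (continuous_absCos F).aestronglyMeasurable 1 (ae_of_all _ fun E => ?_)
  rw [Real.norm_of_nonneg (absCos_nonneg _ _)]
  exact absCos_le_one _ _

lemma continuous_cosineTransform (ν : SignedMeasure (Gr n i)) :
    Continuous (cosineTransform ν) := by
  refine VectorMeasure.continuous_of_dominated (bound := fun _ => 1)
    (fun F => (integrable_absCos ν F).aestronglyMeasurable)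
    (fun F => ae_of_all _ fun E => ?_) (integrable_const _)
    (ae_of_all _ fun E => continuous_absCos E)
  rw [Real.norm_of_nonneg (absCos_nonneg _ _)]
  exact absCos_le_one _ _

lemma cosineTransform_map {X : Type*} [MeasurableSpace X] (ν : SignedMeasure X) {φ : X → Gr n i}
    (hφ : Measurable φ) (F : Gr n i) :
    cosineTransform (ν.map φ) F = ∫ᵛ x, absCos F (φ x) ∂<•ν := by
  have hm := (continuous_absCos F).measurable
  -- Moves the integration variable to the second argument, where continuity, hence measurability,
  -- is known.
  simp_rw [cosineTransform, absCos_comm _ F]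
  refine VectorMeasure.integral_map hφ hm.aestronglyMeasurable ?_
  refine Integrable.of_bound (hm.comp hφ).aestronglyMeasurable 1 (ae_of_all _ fun x => ?_)
  rw [Function.comp_apply, Real.norm_of_nonneg (absCos_nonneg _ _)]
  exact absCos_le_one _ _

lemma cosineTransform_hatToGr (e₀ : S n) (E₀ : Gr n i) (μ : SignedMeasure (S n)) (F : Gr n i) :
    cosineTransform (hatToGr e₀ E₀ μ) F = ∫ᵛ θ, absCos F (toGr E₀ θ⁻¹) ∂<•lift e₀ μ := by
  have h : hatToGr e₀ E₀ μ = (lift e₀ μ).map fun θ => toGr E₀ θ⁻¹ := by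
    ext s hs
    have h₁ := (continuous_toGr E₀).measurable
    have h₂ : Measurable fun θ : O n => θ⁻¹ := measurable_inv
    rw [hatToGr, hatMeasure, VectorMeasure.map_apply _ h₁ hs,
      VectorMeasure.map_apply _ h₂ (h₁ hs), VectorMeasure.map_apply (f := fun θ => toGr E₀ θ⁻¹) _ (h₁.comp h₂) hs]
    rfl
  have hm : Measurable fun θ : O n => toGr E₀ θ⁻¹ :=
    ((continuous_toGr E₀).comp continuous_inv).measurable
  rw [h, cosineTransform_map _ hm]

/-! ### Minkowski valuations with a Crofton measure -/

lemma supp_smul {c : ℝ} (hc : 0 ≤ c) (K : ConvexBody (V n)) (u : V n) :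
    supp (c • K) u = c * supp K u := by
  rw [supp, supp, ← smul_eq_mul, ← Real.sSup_smul_of_nonneg hc, ConvexBody.coe_smul]
  congr 1
  rw [← image_smul, ← image_smul, image_image, image_image]
  simp [real_inner_smul_left]

lemma rot_smul (θ : O n) (c : ℝ) (K : ConvexBody (V n)) : rot θ (c • K) = c • rot θ K := by
  apply SetLike.coe_injective
  change θ.1 '' (c • K : ConvexBody (V n)) = c • (θ.1 '' K)
  rw [ConvexBody.coe_smul, image_smul_set]

/-- The values of a Minkowski valuation with a Crofton measure on convex bodies contained in an
`i`-dimensional subspace. -/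
lemma IsCroftonMeasure.supp_eq {e₀ : S n} {E₀ : Gr n i}
    {Φ : ConvexBody (V n) → ConvexBody (V n)} {μ : SignedMeasure (S n)}
    (hμ : IsCroftonMeasure e₀ E₀ Φ μ) (E : Gr n i) {K : ConvexBody (V n)}
    (hK : (K : Set (V n)) ⊆ E.1) (η : O n) :
    supp (Φ K) (toSphere e₀ η)
      = (μHE[i] (K : Set (V n))).toReal
        * cosineTransform (hatToGr e₀ E₀ μ) (toGr E η⁻¹) := by
  rw [hμ K η, conv, cosineTransform_hatToGr, ← smul_eq_mul, ← VectorMeasure.integral_fun_smul]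
  congr 1
  funext θ
  -- Pulls `vol_i(K)` out of `vol_i(K|ηθ⁻¹E₀)` and matches the remaining `|cos(E, ηθ⁻¹E₀)|` with
  -- `|cos(η⁻¹E, θ⁻¹E₀)|`.
  rw [Function.comp_apply, volProj_eq_absCos_mul E _ hK, absCos_toGr_inv, ← toGr_mul, mul_comm,
    smul_eq_mul]

/-- The unit ball of a subspace. -/
def Gr.unitBall (E : Gr n i) : ConvexBody (V n) where
  carrier := Subtype.val '' Metric.closedBall (0 : E.1) 1
  convex' := (convex_closedBall _ _).linear_image E.1.subtype
  isCompact' := (isCompact_closedBall _ _).image continuous_subtype_val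
  nonempty' := (Metric.nonempty_closedBall.2 zero_le_one).image _

lemma Gr.coe_unitBall (E : Gr n i) :
    (E.unitBall : Set (V n)) = Subtype.val '' Metric.closedBall (0 : E.1) 1 := rfl

lemma Gr.mem_unitBall (E : Gr n i) (x : V n) :
    x ∈ (E.unitBall : Set (V n)) ↔ x ∈ E.1 ∧ ‖x‖ ≤ 1 := by
  simp [Gr.coe_unitBall, and_comm]

lemma Gr.unitBall_volume_pos (E : Gr n i) : 0 < (μHE[i] (E.unitBall : Set (V n))).toReal := by
  have h : (μHE[i] : Measure E.1) = volume := by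
    obtain ⟨E, rfl⟩ := E
    exact InnerProductSpace.euclideanHausdorffMeasure_eq_volume
  rw [Gr.coe_unitBall, Isometry.euclideanHausdorffMeasure_image isometry_subtype_coe, h]
  exact ENNReal.toReal_pos (Metric.measure_closedBall_pos _ _ one_pos).ne'
    measure_closedBall_lt_top.ne

/-- The reason for testing with balls: the ball of `E₀` is fixed by the whole stabilizer of `E₀`. -/
lemma Gr.rot_unitBall (E : Gr n i) (θ : O n) : rot θ E.unitBall = (toGr E θ).unitBall := by
  apply SetLike.coe_injective
  ext x
  rw [Gr.mem_unitBall]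
  change x ∈ θ.1 '' (E.unitBall : Set (V n)) ↔ x ∈ θ.1 '' (E.1 : Set (V n)) ∧ _
  constructor
  · rintro ⟨y, hy, rfl⟩
    obtain ⟨hy, h⟩ := (E.mem_unitBall y).1 hy
    exact ⟨⟨y, hy, rfl⟩, (norm_apply θ y).trans_le h⟩
  · rintro ⟨⟨y, hy, rfl⟩, h⟩
    exact ⟨y, (E.mem_unitBall y).2 ⟨hy, (norm_apply θ y).symm.trans_le h⟩, rfl⟩

end MinkVal

end

/-! ### The body `L` and the Klain function -/

theorem theorem6p2 {n i : ℕ} (hi : 1 ≤ i) (hin : i < n)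
    (e₀ : MinkVal.S n) (E₀ : MinkVal.Gr n i)
    (Φ : ConvexBody (MinkVal.V n) → ConvexBody (MinkVal.V n)) (hΦ : MinkVal.IsEvenMVal i Φ)
    (μ : MeasureTheory.SignedMeasure (MinkVal.S n))
    (hμ : MinkVal.IsCroftonMeasure e₀ E₀ Φ μ) :
    ∃ L : ConvexBody (MinkVal.V n),
      (∀ θ : MinkVal.O n, MinkVal.toGr E₀ θ = E₀ → MinkVal.rot θ L = L) ∧
      (fun θ => MinkVal.supp L (MinkVal.toSphere e₀ θ)) =
        MinkVal.hatFun
          (MinkVal.cosineTransform (MinkVal.hatToGr e₀ E₀ μ) ∘ MinkVal.toGr E₀) ∧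
      ∃ g : C(MinkVal.Gr n i, ℝ),
        MinkVal.IsKlainFunction (MinkVal.assocVal e₀ Φ) g ∧
        g ∘ MinkVal.toGr E₀ = MinkVal.hatFun (fun θ => MinkVal.supp L (MinkVal.toSphere e₀ θ)) := by
  -- Dividing by `c` cancels the volume factor, so `L = c⁻¹ Φ(E₀.unitBall)` has exactly the required
  -- support function.
  set c : ℝ := (μHE[i] (E₀.unitBall : Set (MinkVal.V n))).toReal with hc
  have hc0 : 0 < c := E₀.unitBall_volume_pos
  have hsub : (E₀.unitBall : Set (MinkVal.V n)) ⊆ E₀.1 := fun x hx => ((E₀.mem_unitBall x).1 hx).1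
  have hL (θ : MinkVal.O n) :
      MinkVal.supp (c⁻¹ • Φ E₀.unitBall) (MinkVal.toSphere e₀ θ)
        = MinkVal.cosineTransform (MinkVal.hatToGr e₀ E₀ μ) (MinkVal.toGr E₀ θ⁻¹) := by
    rw [MinkVal.supp_smul (inv_nonneg.2 hc0.le), hμ.supp_eq E₀ hsub, ← hc,
      inv_mul_cancel_left₀ hc0.ne']
  refine ⟨c⁻¹ • Φ E₀.unitBall, fun θ hθ => ?_, funext hL,
    ⟨MinkVal.cosineTransform (MinkVal.hatToGr e₀ E₀ μ), MinkVal.continuous_cosineTransform _⟩,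
    fun E K hK => ?_, funext fun θ => ?_⟩
  -- Equivariance passes the symmetry of the ball on to `L`.
  · rw [MinkVal.rot_smul, ← hΦ.equivariant, MinkVal.Gr.rot_unitBall, hθ]
  · have h := hμ.supp_eq E hK 1
    -- At `η = 1` the point `ηe₀` is `e₀` by definition, so `h` speaks of `assocVal`.
    rwa [inv_one, MinkVal.toGr_one, mul_comm] at h
  · simp only [MinkVal.hatFun, hL, inv_inv]
    rfl
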